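/- Let $\mathfrak g$ be a finite-dimensional complex Lie algebra. For $f\in\mathfrak g^*$ put $\mathfrak g_f=\{x\in\mathfrak g : f([x,y])=0 \text{ for all } y\in\mathfrak g\}$. The index of $\mathfrak g$ is $\chi[\mathfrak g]=\min_{f\in\mathfrak g^*}\dim\mathfrak g_f$, and $\mathfrak g$ is called Frobenius if $\chi[\mathfrak g]=0$. For a composition $(b_1,\dots,b_k)$ of a positive integer $n$, let $\mathfrak p(b_1,\dots,b_k)\subseteq\mathfrak{gl}(n,\mathbb C)$ be the standard parabolic subalgebra of block upper triangular matrices with diagonal blocks of sizes $b_1,\dots,b_k$, in this order, and let $\mathfrak p_s(b_1,\dots,b_k)=\mathfrak p(b_1,\dots,b_k)\cap\mathfrak{sl}(n,\mathbb C)$. Let $r\ge 1$ be an integer and let $\alpha_1,\dots,\alpha_r\ge 1$ be integers. Put $a_0=1$, $a_i=\alpha_i(a_0+\cdots+a_{i-1})$ for $1\le i\le r$, and $n=a_0+\cdots+a_r$. Then $\mathfrak p_s(a_0,\dots,a_r)$ is a Frobenius subalgebra of $\mathfrak{sl}(n,\mathbb C)$, that is, $\chi[\mathfrak p_s(a_0,\dots,a_r)]=0$.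 -/

import Mathlib

/- The commutator bracket `⁅A, B⁆ = A * B - B * A` on square matrices. -/
attribute [local instance 100] LieRing.ofAssociativeRing

/-- The stabilizer `𝔤_f = {x ∈ 𝔤 | f [x, y] = 0 for all y ∈ 𝔤}` of a linear form `f ∈ 𝔤*` for the
coadjoint action. -/
def coadjointStabilizer {L : Type*} [LieRing L] [LieAlgebra ℂ L] (f : Module.Dual ℂ L) :
    LieSubalgebra ℂ L where
  carrier := {x | ∀ y : L, f ⁅x, y⁆ = 0}
  zero_mem' := by simp
  add_mem' := by
    intro x z hx hz y
    rw [add_lie, map_add, hx y, hz y, add_zero]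
  smul_mem' := by
    intro t x hx y
    rw [smul_lie, map_smul, hx y, smul_zero]
  lie_mem' := by
    intro x z hx hz y
    rw [lie_lie, map_sub, hx, hz, sub_zero]

/-- The index of a finite-dimensional complex Lie algebra `𝔤`: the minimum of `dim 𝔤_f` over all
linear forms `f ∈ 𝔤*`. (The infimum of a non-empty set of natural numbers is its minimum.) -/
noncomputable def lieIndex (L : Type*) [LieRing L] [LieAlgebra ℂ L] [FiniteDimensional ℂ L] : ℕ :=
  ⨅ f : Module.Dual ℂ L, Module.finrank ℂ (coadjointStabilizer f)

/-- A finite-dimensional complex Lie algebra is Frobenius if its index is zero. -/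
def IsFrobeniusLie (L : Type*) [LieRing L] [LieAlgebra ℂ L] [FiniteDimensional ℂ L] : Prop :=
  lieIndex L = 0

/-- The standard parabolic subalgebra `𝔭(a₁, …, a_k)` of `𝔤𝔩(n)` attached to a composition
`(a₁, …, a_k)` of `n`: the block upper triangular matrices with diagonal blocks of sizes
`a₁, …, a_k` in this order, that is, the matrices stabilizing every subspace spanned by the first
`a₁ + ⋯ + a_i` vectors of the canonical basis. Here `c.index i` is the block containing `i`. -/
def parabolicGl {n : ℕ} (c : Composition n) : LieSubalgebra ℂ (Matrix (Fin n) (Fin n) ℂ) where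
  carrier := {M | M.BlockTriangular c.index}
  zero_mem' := Matrix.blockTriangular_zero
  add_mem' := fun hM hN => Matrix.BlockTriangular.add hM hN
  smul_mem' := by
    intro t M hM i j hij
    rw [Matrix.smul_apply, hM hij, smul_zero]
  lie_mem' := by
    intro M N hM hN
    rw [Ring.lie_def]
    exact Matrix.BlockTriangular.sub (Matrix.BlockTriangular.mul hM hN)
      (Matrix.BlockTriangular.mul hN hM)

/-- `𝔭_s(a₁, …, a_k) = 𝔭(a₁, …, a_k) ∩ 𝔰𝔩(n)`, as a Lie subalgebra of `𝔰𝔩(n)`. -/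
def parabolicSl {n : ℕ} (c : Composition n) :
    LieSubalgebra ℂ (LieAlgebra.SpecialLinear.sl (Fin n) ℂ) :=
  (parabolicGl c).comap (LieAlgebra.SpecialLinear.sl (Fin n) ℂ).incl

/-! Represent a linear form on the parabolic as `X ↦ tr(F X)`. Since `tr(F [X, Y]) = tr([F, X] Y)`,
its stabilizer consists of the `X` for which `[F, X]` is trace-orthogonal to the parabolic, i.e.
strictly block upper triangular. Rigidity of `F` makes such an `X` scalar, hence zero in `𝔰𝔩(n)`
(`IsRigidForm.isFrobeniusLie`). Rigid matrices are built by induction on the number of blocks. If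
the preceding blocks have total size `s` and the new one has size `m * s`, the indices split into `m
+ 1` copies of the old index set, the new block being copies `1, …, m`. The old `F` on copy `0` plus
the shift between copies is again rigid (`IsRigidForm.shiftExtension`). -/

/-- A matrix `F` is rigid for the block structure `b` if the only block upper triangular matrices
whose commutator with `F` is strictly block upper triangular are the scalar ones. -/
def IsRigidForm {ι : Type*} [Fintype ι] [DecidableEq ι] (b : ι → ℕ) (F : Matrix ι ι ℂ) : Prop :=
  ∀ X : Matrix ι ι ℂ, X.BlockTriangular b →
    (∀ i j, b j ≤ b i → (F * X - X * F) i j = 0) → ∃ t : ℂ, X = Matrix.scalar ι t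

theorem IsRigidForm.submatrix {ι κ : Type*} [Fintype ι] [DecidableEq ι] [Fintype κ]
    [DecidableEq κ] {b : ι → ℕ} {F : Matrix ι ι ℂ} (hF : IsRigidForm b F) (e : κ ≃ ι)
    {b' : κ → ℕ} (hb : ∀ k, b' k = b (e k)) : IsRigidForm b' (F.submatrix e e) := by
  intro X hX h
  obtain ⟨t, ht⟩ := hF (X.submatrix e.symm e.symm)
    (fun i j hij => hX (by simpa [hb] using hij)) (by
      intro i j hij
      have h1 := h (e.symm i) (e.symm j) (by simpa [hb] using hij)
      have h2 : F.submatrix e e * X - X * F.submatrix e e =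
          (F * X.submatrix e.symm e.symm - X.submatrix e.symm e.symm * F).submatrix e e := by
        have hX' : X = (X.submatrix e.symm e.symm).submatrix e e := by
          ext; simp
        conv_lhs => rw [hX']
        rw [Matrix.submatrix_mul_equiv, Matrix.submatrix_mul_equiv, Matrix.submatrix_sub]
        rfl
      rw [h2] at h1
      simpa using h1)
  refine ⟨t, ?_⟩
  ext i j
  have := congrFun (congrFun ht (e i)) (e j)
  simpa [Matrix.diagonal_apply] using this

/-! ### Adding one block: the shift construction -/

/-- The rigid matrix on `m + 1` copies of `ι`: `F` on the copy `0`, plus the shift sending each copy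
identically to the next one. -/
def shiftExtension {ι : Type*} [DecidableEq ι] (m : ℕ) (F : Matrix ι ι ℂ) :
    Matrix (Fin (m + 1) × ι) (Fin (m + 1) × ι) ℂ :=
  Matrix.of (fun x y => if x.1 = 0 ∧ y.1 = 0 then F x.2 y.2 else 0) +
    Matrix.of (fun x y => if x.1.val = y.1.val + 1 ∧ x.2 = y.2 then 1 else 0)

section ShiftExtension

variable {ι : Type*} [Fintype ι] [DecidableEq ι] {m : ℕ} (F : Matrix ι ι ℂ)
  (X : Matrix (Fin (m + 1) × ι) (Fin (m + 1) × ι) ℂ)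

theorem shiftExtension_mul_zero_apply (i : ι) (y : Fin (m + 1) × ι) :
    (shiftExtension m F * X) (0, i) y = ∑ k, F i k * X (0, k) y := by
  simp only [shiftExtension, Matrix.mul_apply, Matrix.add_apply, Matrix.of_apply,
    Fintype.sum_prod_type]
  rw [Finset.sum_eq_single 0 (by intro p _ hp; simp [hp]) (by simp)]
  simp

theorem shiftExtension_mul_succ_apply (p : ℕ) (hp : p + 1 < m + 1) (i : ι)
    (y : Fin (m + 1) × ι) :
    (shiftExtension m F * X) (⟨p + 1, hp⟩, i) y = X (⟨p, by omega⟩, i) y := by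
  rw [Matrix.mul_apply, Finset.sum_eq_single (⟨p, by omega⟩, i)]
  · simp [shiftExtension]
  · rintro ⟨q, j⟩ _ hq
    have : ¬ (p = q.val ∧ i = j) := by
      rintro ⟨h1, h2⟩
      exact hq (Prod.ext (Fin.ext h1.symm) h2.symm)
    simp [shiftExtension, this]
  · simp

theorem mul_shiftExtension_apply (x : Fin (m + 1) × ι) (q : ℕ) (hq : q < m + 1) (j : ι) :
    (X * shiftExtension m F) x (⟨q, hq⟩, j) =
      (if q = 0 then ∑ k, X x (0, k) * F k j else 0) +
        (if h : q + 1 < m + 1 then X x (⟨q + 1, h⟩, j) else 0) := by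
  rw [shiftExtension, Matrix.mul_add, Matrix.add_apply]
  congr 1
  · rw [Matrix.mul_apply, Fintype.sum_prod_type,
      Finset.sum_eq_single 0 (by intro p _ hp; simp [hp]) (by simp)]
    by_cases h : q = 0 <;> simp [Fin.mk_eq_zero, h]
  · rw [Matrix.mul_apply]
    split_ifs with h
    · rw [Finset.sum_eq_single (⟨q + 1, h⟩, j)]
      · simp
      · rintro ⟨p, k⟩ _ hp
        have : ¬ (p.val = q + 1 ∧ k = j) := by
          rintro ⟨h1, h2⟩
          exact hp (Prod.ext (Fin.ext h1) h2)
        simp [this]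
      · simp
    · refine Finset.sum_eq_zero ?_
      rintro ⟨p, k⟩ _
      have : p.val ≠ q + 1 := by have := p.isLt; omega
      simp [this]

variable {F}

/-- Commuting with the shift in the rows of the last block makes `X` block Toeplitz. Its first block
column vanishes below the top by triangularity, and this kills everything below the diagonal;
diagonals above it run off the right edge and vanish too. What remains is `Y 0 0` repeated, to which
rigidity of `F` applies. -/
theorem IsRigidForm.shiftExtension {b : ι → ℕ} (hF : IsRigidForm b F) {r : ℕ}
    (hb : ∀ i, b i < r) :
    IsRigidForm (fun x : Fin (m + 1) × ι => if x.1 = 0 then b x.2 else r)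
      (shiftExtension m F) := by
  intro X hX h
  -- Blocks of `X`, set to zero out of range so that the Toeplitz relation also holds at the last
  -- column.
  let Y : ℕ → ℕ → Matrix ι ι ℂ := fun p q =>
    Matrix.of fun i j => if hpq : p < m + 1 ∧ q < m + 1 then
      X (⟨p, hpq.1⟩, i) (⟨q, hpq.2⟩, j) else 0
  have hYX : ∀ (p q : Fin (m + 1)) i j, X (p, i) (q, j) = Y p q i j := by
    intro p q i j
    simp only [Y, Matrix.of_apply]
    rw [dif_pos ⟨p.isLt, q.isLt⟩]
  have hcol : ∀ p, Y (p + 1) 0 = 0 := by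
    intro p
    ext i j
    by_cases hp : p + 1 < m + 1
    · have := @hX (⟨p + 1, hp⟩, i) (0, j) (by simpa [Fin.ext_iff] using hb j)
      rw [hYX] at this
      simpa using this
    · simp only [Y, Matrix.of_apply]
      rw [dif_neg (by tauto), Matrix.zero_apply]
  have hlarge : ∀ p q, m < q → Y p q = 0 := by
    intro p q hq
    ext i j
    simp only [Y, Matrix.of_apply]
    rw [dif_neg (by omega), Matrix.zero_apply]
  have hstep : ∀ p q, p < m → Y p q = Y (p + 1) (q + 1) := by
    intro p q hp
    by_cases hq : q < m + 1
    swap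
    · rw [hlarge p q (by omega), hlarge _ _ (by omega)]
    ext i j
    -- Row copy `p + 1` lies in the last block, so the commutator vanishes there in every column.
    have h1 := h (⟨p + 1, by omega⟩, i) (⟨q, hq⟩, j) (by
      simp only [Fin.ext_iff]
      split_ifs <;> simp_all [(hb _).le])
    rw [Matrix.sub_apply, shiftExtension_mul_succ_apply, mul_shiftExtension_apply, hYX] at h1
    have h2 : (if q = 0 then ∑ k, X (⟨p + 1, by omega⟩, i) (0, k) * F k j else 0) = 0 := by
      split_ifs
      · refine Finset.sum_eq_zero fun k _ => ?_
        rw [hYX]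
        simp [hcol]
      · rfl
    rw [h2, zero_add, sub_eq_zero] at h1
    rw [h1]
    split_ifs with hq'
    · rw [hYX]
    · rw [hlarge _ _ (by omega), Matrix.zero_apply]
  have hiter : ∀ t p q, p + t ≤ m → Y p q = Y (p + t) (q + t) := by
    intro t
    induction t with
    | zero => intro p q _; rfl
    | succ t ih =>
      intro p q hpt
      rw [ih p q (by omega), hstep _ _ (by omega)]
      rfl
  have hupper : ∀ p q, p ≤ m → p < q → Y p q = 0 := by
    intro p q hp hpq
    rw [hiter (m - p) p q (by omega), hlarge _ _ (by omega)]
  have hlower : ∀ p q, p ≤ m → q < p → Y p q = 0 := by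
    intro p q hp hpq
    obtain ⟨d, rfl⟩ : ∃ d, p = d + 1 + q := ⟨p - q - 1, by omega⟩
    have := hiter q (d + 1) 0 hp
    rw [zero_add] at this
    rw [← this, hcol]
  have hdiag : ∀ p, p ≤ m → Y p p = Y 0 0 := by
    intro p hp
    have := hiter p 0 0 (by omega)
    rw [zero_add] at this
    exact this.symm
  obtain ⟨t, ht⟩ := hF (Y 0 0)
    (by
      intro i j hij
      have := @hX (0, i) (0, j) (by simpa using hij)
      rw [hYX] at this
      simpa using this)
    (by
      intro i j hij
      have h1 := h (0, i) (⟨0, by omega⟩, j) (by simpa using hij)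
      rw [Matrix.sub_apply, shiftExtension_mul_zero_apply, mul_shiftExtension_apply] at h1
      have h2 : (if h : 0 + 1 < m + 1 then X (0, i) (⟨0 + 1, h⟩, j) else 0) = 0 := by
        split_ifs
        · rw [hYX]
          simp [hupper 0 1]
        · rfl
      rw [h2, add_zero, if_pos rfl] at h1
      rw [Matrix.sub_apply, Matrix.mul_apply, Matrix.mul_apply]
      simp only [hYX] at h1
      exact h1)
  refine ⟨t, ?_⟩
  ext ⟨p, i⟩ ⟨q, j⟩
  rw [hYX]
  rcases lt_trichotomy p.val q.val with hpq | hpq | hpq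
  · rw [hupper _ _ (by omega) hpq]
    simp [Fin.ext_iff, hpq.ne]
  · obtain rfl := Fin.ext hpq
    rw [hdiag _ (by omega), ht]
    simp [Matrix.diagonal_apply]
  · rw [hlower _ _ (by omega) hpq]
    simp [Fin.ext_iff, hpq.ne']

end ShiftExtension

/-! ### Existence of rigid forms -/

/-- A rigid form exists as soon as the first block has size one and the size of every other block is
a multiple of the sum of the preceding sizes. -/
theorem exists_isRigidForm (a : ℕ → ℕ) (r : ℕ) (h_zero : a 0 = 1)
    (h_succ : ∀ i < r, (∑ j ∈ Finset.range (i + 1), a j) ∣ a (i + 1)) :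
    ∀ {κ : Type} [Fintype κ] [DecidableEq κ] (b : κ → ℕ), (∀ k, b k ≤ r) →
      (∀ i ≤ r, Fintype.card {k // b k = i} = a i) → ∃ F : Matrix κ κ ℂ, IsRigidForm b F := by
  induction r with
  | zero =>
    intro κ _ _ b hb hcard
    refine ⟨0, fun X _ _ => ?_⟩
    have hκ : Fintype.card κ = 1 := by
      rw [← h_zero, ← hcard 0 le_rfl]
      exact Fintype.card_congr (Equiv.subtypeUnivEquiv fun k => Nat.le_zero.mp (hb k)).symm
    obtain ⟨k, hk⟩ := Fintype.card_eq_one_iff.mp hκ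
    refine ⟨X k k, ?_⟩
    ext i j
    rw [hk i, hk j]
    simp
  | succ r ih =>
    intro κ _ _ b hb hcard
    let ι := {k // b k ≤ r}
    obtain ⟨F, hF⟩ := ih (fun i hi => h_succ i (by omega)) (fun x : ι => b x) (fun x => x.2) (by
      intro i hi
      rw [← hcard i (by omega)]
      exact Fintype.card_congr
        (Equiv.subtypeSubtypeEquivSubtype (q := fun k => b k = i) (fun h => h.trans_le hi)))
    have hι : Fintype.card ι = ∑ j ∈ Finset.range (r + 1), a j := by
      rw [Fintype.card_subtype, Finset.card_eq_sum_card_fiberwise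
        (t := Finset.range (r + 1)) (f := b) (by intro k hk; simpa [Nat.lt_succ_iff] using hk)]
      refine Finset.sum_congr rfl fun i hi => ?_
      rw [Finset.mem_range] at hi
      rw [← hcard i (by omega), Fintype.card_subtype]
      congr 1
      ext k
      simp only [Finset.mem_filter, Finset.mem_univ, true_and]
      omega
    obtain ⟨m, hm⟩ := h_succ r (by omega)
    have e : {k // ¬ b k ≤ r} ≃ Fin m × ι := by
      refine Fintype.equivOfCardEq ?_
      rw [Fintype.card_prod, Fintype.card_fin, hι, mul_comm, ← hm, ← hcard (r + 1) le_rfl]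
      refine Fintype.card_congr (Equiv.subtypeEquivRight fun k => ?_)
      have := hb k
      omega
    -- Copy `0` is the union of the old blocks; the last block fills the other `m` copies through
    -- `e`.
    let g : κ → Fin (m + 1) × ι := fun k =>
      if h : b k ≤ r then (0, ⟨k, h⟩) else ((e ⟨k, h⟩).1.succ, (e ⟨k, h⟩).2)
    have hg : Function.Bijective g := by
      constructor
      · intro k l hkl
        by_cases hk : b k ≤ r <;> by_cases hl : b l ≤ r
        · simp only [g, hk, hl, dif_pos, Prod.mk.injEq, true_and] at hkl
          exact congrArg Subtype.val hkl
        · simp [g, hk, hl, Prod.ext_iff, (Fin.succ_ne_zero _).symm] at hkl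
        · simp [g, hk, hl, Prod.ext_iff, Fin.succ_ne_zero] at hkl
        · simp only [g, hk, hl, dif_neg, not_false_eq_true, Prod.mk.injEq, Fin.succ_inj] at hkl
          simpa using e.injective (Prod.ext hkl.1 hkl.2)
      · rintro ⟨p, x⟩
        induction p using Fin.cases with
        | zero => exact ⟨x, by simp [g, x.2]⟩
        | succ p =>
          refine ⟨(e.symm (p, x) : κ), ?_⟩
          simp [g, (e.symm (p, x)).2]
    refine ⟨_, (hF.shiftExtension (m := m) (r := r + 1)
      (fun i => Nat.lt_succ_of_le i.2)).submatrix (Equiv.ofBijective g hg) fun k => ?_⟩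
    by_cases hk : b k ≤ r
    · simp [g, hk]
    · have := hb k
      simp only [Equiv.ofBijective_apply, g, hk, dif_neg, not_false_eq_true, Fin.succ_ne_zero,
        if_false]
      omega

/-! ### From rigid forms to index zero -/

/-- A rigid form for the blocks of a composition makes the parabolic subalgebra of `𝔰𝔩(n)`
Frobenius. -/
theorem IsRigidForm.isFrobeniusLie {n : ℕ} (hn : n ≠ 0) {c : Composition n}
    {F : Matrix (Fin n) (Fin n) ℂ} (hF : IsRigidForm (fun i => (c.index i : ℕ)) F) :
    IsFrobeniusLie (parabolicSl c) := by
  let f : Module.Dual ℂ (parabolicSl c) :=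
    { toFun := fun x => (F * (x : LieAlgebra.SpecialLinear.sl (Fin n) ℂ).1).trace
      map_add' := by
        intro x y
        rw [← Matrix.trace_add, ← Matrix.mul_add]
        rfl
      map_smul' := by
        intro t x
        rw [RingHom.id_apply, ← Matrix.trace_smul, ← Matrix.mul_smul]
        rfl }
  have hnC : (n : ℂ) ≠ 0 := Nat.cast_ne_zero.mpr hn
  have hf : ∀ x : parabolicSl c, x ∈ coadjointStabilizer f → x = 0 := by
    rintro ⟨⟨X, hXtr⟩, hX⟩ hx
    have hXb : X.BlockTriangular c.index := hX
    have hXt : X.trace = 0 := hXtr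
    obtain ⟨t, ht⟩ := hF X (fun i j hij => hXb hij) (by
      intro i j hij
      -- Pairing with `E_{ji}` extracts the `(i, j)` entry of `[F, X]`. The scalar correction makes
      -- `Y` traceless and does not affect the pairing, as `tr [F, X] = 0`.
      let Y : Matrix (Fin n) (Fin n) ℂ :=
        Matrix.single j i 1 - Matrix.scalar (Fin n) ((if i = j then 1 else 0) / (n : ℂ))
      have hYt : Y.trace = 0 := by
        simp only [Y, Matrix.trace_sub]
        by_cases h : i = j
        · subst h
          simp [Matrix.trace, hnC]
        · simp [Matrix.trace_single_eq_of_ne, h, Ne.symm h]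
      have hYb : Y.BlockTriangular c.index := by
        refine Matrix.BlockTriangular.sub ?_ (Matrix.blockTriangular_diagonal _)
        intro k l hkl
        rw [Matrix.single_apply_of_ne]
        rintro ⟨rfl, rfl⟩
        exact absurd hij (not_le.mpr hkl)
      have h1 := hx ⟨⟨Y, hYt⟩, hYb⟩
      have h2 : (F * (X * Y - Y * X)).trace = 0 := h1
      have h3 : (F * (X * Y - Y * X)).trace = ((F * X - X * F) * Y).trace := by
        rw [Matrix.mul_sub, Matrix.sub_mul (F * X), Matrix.trace_sub, Matrix.trace_sub, Matrix.mul_assoc,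
          ← Matrix.mul_assoc F Y X, Matrix.trace_mul_comm (F * Y) X, Matrix.mul_assoc]
      have h4 : (F * X - X * F).trace = 0 := by
        rw [Matrix.trace_sub, Matrix.trace_mul_comm, sub_self]
      rw [h3, Matrix.mul_sub, Matrix.trace_sub, Matrix.scalar_apply,
        ← Matrix.smul_one_eq_diagonal, Matrix.mul_smul, Matrix.mul_one, Matrix.trace_smul, h4,
        smul_zero, sub_zero, Matrix.trace_mul_single] at h2
      simpa using h2)
    have ht0 : t = 0 := by
      rw [ht] at hXt
      simpa [Matrix.trace, hnC] using hXt
    refine Subtype.ext (Subtype.ext ?_)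
    change X = 0
    rw [ht, ht0, map_zero]
  have hfin : Module.finrank ℂ (coadjointStabilizer f) = 0 := by
    have : Subsingleton (coadjointStabilizer f) :=
      ⟨fun x y => Subtype.ext ((hf x x.2).trans (hf y y.2).symm)⟩
    exact Module.finrank_zero_of_subsingleton
  exact Nat.le_zero.mp (hfin ▸ ciInf_le (OrderBot.bddBelow _) f)

theorem Composition.card_index_eq {n : ℕ} (c : Composition n) (i : Fin c.length) :
    Fintype.card {k // c.index k = i} = c.blocksFun i := by
  rw [← Fintype.card_fin (c.blocksFun i)]
  refine (Fintype.card_congr (Equiv.ofBijective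
    (fun j => (⟨c.embedding i j, c.index_embedding i j⟩ : {k // c.index k = i})) ⟨?_, ?_⟩)).symm
  · intro j k h
    exact (c.embedding i).injective (congrArg Subtype.val h)
  · rintro ⟨k, rfl⟩
    exact ⟨c.invEmbedding k, Subtype.ext (c.embedding_comp_inv k)⟩

theorem mainTheorem8 (r : ℕ) (hr : 1 ≤ r)
    -- `α i` multiplies the sum `a 0 + ⋯ + a i` to give `a (i + 1)`, for `0 ≤ i < r`
    (α : Fin r → ℕ) (hα : ∀ i, 1 ≤ α i)
    (a : Fin (r + 1) → ℕ) (ha_zero : a 0 = 1)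
    (ha_succ : ∀ i : Fin r, a i.succ = α i * ∑ j ∈ Finset.Iic i.castSucc, a j)
    (n : ℕ) (hn : n = ∑ i, a i)
    -- `c` is the composition `(a 0, …, a r)` of `n`
    (c : Composition n) (hc : c.blocks = List.ofFn a) :
    IsFrobeniusLie (parabolicSl c) := by
  have hn0 : n ≠ 0 := by
    have := Finset.single_le_sum (f := a) (fun i _ => Nat.zero_le _) (Finset.mem_univ 0)
    omega
  let a' : ℕ → ℕ := fun i => if h : i < r + 1 then a ⟨i, h⟩ else 0
  have ha' : ∀ i : Fin (r + 1), a' i = a i := fun i => dif_pos i.isLt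
  have hlen : c.length = r + 1 := by
    rw [Composition.length, hc, List.length_ofFn]
  obtain ⟨F, hF⟩ := exists_isRigidForm a' r (by simpa [a'] using ha_zero)
    (by
      intro i hi
      have h1 := ha_succ ⟨i, hi⟩
      have h2 : ∑ j ∈ Finset.range (i + 1), a' j =
          ∑ j ∈ Finset.Iic (Fin.castSucc ⟨i, hi⟩), a j := by
        symm
        refine Finset.sum_bij (fun j _ => j.val) ?_ ?_ ?_ ?_
        · intro j hj
          simpa [Fin.le_def, Nat.lt_succ_iff] using hj
        · intro j _ k _ h
          exact Fin.ext h
        · intro j hj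
          rw [Finset.mem_range] at hj
          exact ⟨⟨j, by omega⟩, by simp [Fin.le_def]; omega, rfl⟩
        · intro j _
          exact (ha' j).symm
      rw [h2]
      exact Dvd.intro_left _ (h1.symm.trans (ha' (Fin.succ ⟨i, hi⟩)).symm))
    (fun k : Fin n => (c.index k : ℕ))
    (fun k => by have := (c.index k).isLt; omega)
    (by
      intro i hi
      have hi' : i < c.length := by omega
      have h1 := c.card_index_eq ⟨i, hi'⟩
      have h2 : c.blocksFun ⟨i, hi'⟩ = a' i := by
        rw [ha' ⟨i, Nat.lt_succ_of_le hi⟩]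
        simp only [Composition.blocksFun, List.get_eq_getElem, hc, List.getElem_ofFn]
      rw [← h2, ← h1]
      exact Fintype.card_congr (Equiv.subtypeEquivRight fun k => by rw [Fin.ext_iff]))
  exact hF.isFrobeniusLie hn0
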